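/- Let $F$ be any field. For a Lie algebra $L$ over $F$, the (nonabelian) tensor square $L\otimes L$ is the Lie algebra over $F$ generated by the symbols $l\otimes k$ ($l,k\in L$) subject to the relations $$c(l\otimes k)=cl\otimes k=l\otimes ck,\qquad (l+l')\otimes k=l\otimes k+l'\otimes k,\qquad l\otimes(k+k')=l\otimes k+l\otimes k',$$ $$[l,l']\otimes k=l\otimes[l',k]-l'\otimes[l,k],\qquad l\otimes[k,k']=[k',l]\otimes k-[k,l]\otimes k',$$ $$[\,l\otimes k,\;l'\otimes k'\,]=-[k,l]\otimes[l',k']$$ for all $c\in F$ and $l,l',k,k'\in L$. Let $L$ be an $n$-dimensional non-abelian nilpotent Lie algebra over $F$ whose derived subalgebra $[L,L]$ has dimension $m$, where $n\ge 4$ and $m\ge 2$. Then $L\otimes L$ is finite-dimensional, and either $$\dim(L\otimes L)\le (n-m)(n-1)+1,$$ or $$\dim(L\otimes L)\le (n-m)(n-1)+2<n(n-m).$$ In particular, $\dim(L\otimes L)<n(n-m)$. -/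

import Mathlib

namespace LieNonabTensor

section General

variable (F : Type*) [Field F] {M N : Type*}
  [LieRing M] [LieAlgebra F M] [LieRing N] [LieAlgebra F N]

/-- The symbol `m ⊗ n` in the free Lie algebra on `M × N`. -/
noncomputable def sym (m : M) (n : N) : FreeLieAlgebra F (M × N) :=
  FreeLieAlgebra.of F (m, n)

variable {F}

/-- The relators of the nonabelian tensor product of two Lie algebras acting on each other.
An action of `M` on `N` is a Lie algebra homomorphism `α` from `M` to the derivations of `N`
(that is, a bilinear map `(m, n) ↦ α m n` with `α ⁅m, m'⁆ n = α m (α m' n) - α m' (α m n)` and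
`α m ⁅n, n'⁆ = ⁅α m n, n'⁆ + ⁅n, α m n'⁆`), and likewise `β` is an action of `N` on `M`. -/
inductive Relator (α : M →ₗ⁅F⁆ LieDerivation F N N) (β : N →ₗ⁅F⁆ LieDerivation F M M) :
    FreeLieAlgebra F (M × N) → Prop
  | smul_left (c : F) (m : M) (n : N) : Relator α β (c • sym F m n - sym F (c • m) n)
  | smul_right (c : F) (m : M) (n : N) : Relator α β (c • sym F m n - sym F m (c • n))
  | add_left (m m' : M) (n : N) :
      Relator α β (sym F (m + m') n - (sym F m n + sym F m' n))
  | add_right (m : M) (n n' : N) :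
      Relator α β (sym F m (n + n') - (sym F m n + sym F m n'))
  | lie_left (m m' : M) (n : N) :
      Relator α β (sym F ⁅m, m'⁆ n - (sym F m (α m' n) - sym F m' (α m n)))
  | lie_right (m : M) (n n' : N) :
      Relator α β (sym F m ⁅n, n'⁆ - (sym F (β n' m) n - sym F (β n m) n'))
  | lie_lie (m m' : M) (n n' : N) :
      Relator α β (⁅sym F m n, sym F m' n'⁆ - (-sym F (β n m) (α m' n')))

/-- The ideal of the free Lie algebra on `M × N` generated by the relators. -/
noncomputable def relatorIdeal (α : M →ₗ⁅F⁆ LieDerivation F N N)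
    (β : N →ₗ⁅F⁆ LieDerivation F M M) : LieIdeal F (FreeLieAlgebra F (M × N)) :=
  LieSubmodule.lieSpan F (FreeLieAlgebra F (M × N)) {x | Relator α β x}

/-- The nonabelian tensor product `M ⊗ N` of Lie algebras acting on each other: the Lie algebra
generated by the symbols `m ⊗ n` subject to the relations above. -/
abbrev TensorProd (α : M →ₗ⁅F⁆ LieDerivation F N N) (β : N →ₗ⁅F⁆ LieDerivation F M M) : Type _ :=
  FreeLieAlgebra F (M × N) ⧸ relatorIdeal α β

end General

/-- The nonabelian tensor square `L ⊗ L`: here `L` acts on itself by its Lie bracket. -/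
abbrev TensorSquare (F L : Type*) [Field F] [LieRing L] [LieAlgebra F L] : Type _ :=
  TensorProd (LieDerivation.ad F L) (LieDerivation.ad F L)

end LieNonabTensor

/-! Let `X` be a complement of `[L, L]`, of dimension `d = n - m`. Since `X` generates the nilpotent
algebra `L`, the symbols `l ⊗ x` with `x ∈ X` span the tensor square (`tensorSquareLift_range`), so
its dimension is `n * d - dim K`, with `K` the kernel of `L ⊗ X → TensorSquare F L`. It remains to
find elements of `K`. Choose `x, y ∈ X` with `c = ⁅x, y⁆ ≠ 0`. The Jacobi-type identity `c ⊗ z + ⁅y,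
z⁆ ⊗ x - ⁅x, z⁆ ⊗ y = 0` gives `dim K ≥ d - 2`, which suffices for `d ≥ 3`. For `d = 2`, expanding
`c ⊗ c = 0` gives a nonzero element of `K`, unless `c` is central and `dim L ≤ 3`. -/

open TensorProduct

/-! ### Generation of a nilpotent Lie algebra modulo its derived ideal -/

section Generation

variable {F L : Type*} [Field F] [LieRing L] [LieAlgebra F L]

/-- In a nilpotent Lie algebra, a subalgebra supplementing the derived ideal is everything. -/
theorem LieSubalgebra.eq_top_of_sup_derived_eq_top [LieRing.IsNilpotent L]
    (S : LieSubalgebra F L)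
    (hS : S.toSubmodule ⊔
      (⁅(⊤ : LieIdeal F L), (⊤ : LieIdeal F L)⁆ : LieIdeal F L).toSubmodule = ⊤) :
    S = ⊤ := by
  -- If `L = S + γ_k`, then `[L, L] ⊆ [S, S] + [L, γ_k] ⊆ S + γ_(k+1)`, so `S + γ_(k+1)` is again
  -- `L`; eventually `γ_k = 0`.
  have key : ∀ k, S.toSubmodule ⊔
      (LieModule.lowerCentralSeries F L L k).toSubmodule = ⊤ := by
    intro k
    induction k with
    | zero => simp
    | succ k ih =>
      rw [eq_top_iff, ← hS, LieSubmodule.lieIdeal_oper_eq_linear_span']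
      refine sup_le le_sup_left (Submodule.span_le.2 ?_)
      rintro _ ⟨a, -, b, -, rfl⟩
      obtain ⟨s, hs, g, hg, rfl⟩ := Submodule.mem_sup.1 (ih ▸ Submodule.mem_top : a ∈ _)
      have hb : b ∈ S.toSubmodule ⊔ (LieModule.lowerCentralSeries F L L k).toSubmodule :=
        ih ▸ Submodule.mem_top
      obtain ⟨s', hs', g', hg', hb'⟩ := Submodule.mem_sup.1 hb
      have hγ : ∀ w, ∀ u ∈ LieModule.lowerCentralSeries F L L k,
          ⁅w, u⁆ ∈ LieModule.lowerCentralSeries F L L (k + 1) := fun w u hu => by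
        rw [LieModule.lowerCentralSeries_succ]
        exact LieSubmodule.lie_mem_lie (LieSubmodule.mem_top w) hu
      have e : ⁅s + g, b⁆ = ⁅s, s'⁆ + (⁅s, g'⁆ - ⁅b, g⁆) := by
        rw [add_lie, ← lie_skew b g, ← hb', lie_add]
        abel
      rw [e]
      exact Submodule.add_mem_sup (S.lie_mem hs hs') (sub_mem (hγ _ _ hg') (hγ _ _ hg))
  obtain ⟨k, hk⟩ := LieModule.IsNilpotent.nilpotent F L L
  have h := key k
  rw [hk, LieSubmodule.bot_toSubmodule, sup_bot_eq] at h
  rw [← LieSubalgebra.toSubmodule_inj, h, LieSubalgebra.top_toSubmodule]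

/-- An element commuting with a supplement of the derived ideal is central. -/
theorem lie_eq_zero_of_sup_derived_eq_top [LieRing.IsNilpotent L] {X : Submodule F L}
    (hX : X ⊔ (⁅(⊤ : LieIdeal F L), (⊤ : LieIdeal F L)⁆ : LieIdeal F L).toSubmodule = ⊤)
    {w : L} (hw : ∀ x ∈ X, ⁅w, x⁆ = 0) (z : L) : ⁅w, z⁆ = 0 := by
  let S : LieSubalgebra F L :=
    { LinearMap.ker (LieAlgebra.ad F L w : L →ₗ[F] L) with
      lie_mem' := by
        intro a b ha hb
        simp only [AddSubsemigroup.mem_carrier, AddSubmonoid.mem_toSubsemigroup,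
          Submodule.mem_toAddSubmonoid, LinearMap.mem_ker, LieAlgebra.ad_apply] at ha hb ⊢
        rw [leibniz_lie, ha, hb, zero_lie, lie_zero, add_zero] }
  have hS : S = ⊤ := by
    refine S.eq_top_of_sup_derived_eq_top (top_le_iff.1 (hX.ge.trans (sup_le_sup_right ?_ _)))
    exact fun x hx => hw x hx
  have : z ∈ S := hS ▸ LieSubalgebra.mem_top z
  exact this

/-- If `X` commuted with itself, each of its elements would be central; then every element of `L`
would commute with `X`, hence be central. -/
theorem exists_lie_ne_zero_of_sup_derived_eq_top [LieRing.IsNilpotent L] {X : Submodule F L}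
    (hX : X ⊔ (⁅(⊤ : LieIdeal F L), (⊤ : LieIdeal F L)⁆ : LieIdeal F L).toSubmodule = ⊤)
    (hnab : ¬ IsLieAbelian L) : ∃ x ∈ X, ∃ y ∈ X, ⁅x, y⁆ ≠ 0 := by
  by_contra! h
  refine hnab ⟨fun a b => ?_⟩
  refine lie_eq_zero_of_sup_derived_eq_top hX (fun x hx => ?_) b
  rw [← lie_skew, lie_eq_zero_of_sup_derived_eq_top hX (fun y hy => h x hx y hy) a, neg_zero]

theorem linearIndependent_pair_of_lie_ne_zero {x y : L} (h : ⁅x, y⁆ ≠ 0) :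
    LinearIndependent F ![x, y] := by
  rw [LinearIndependent.pair_iff]
  intro s t hst
  constructor
  · have := congrArg (⁅·, y⁆) hst
    simpa [h] using this
  · have := congrArg (⁅x, ·⁆) hst
    simpa [h] using this

/-- If the abelianization of a nilpotent Lie algebra is spanned by `x` and `y`, and `⁅x, y⁆`
commutes with both, then the dimension is at most three. -/
theorem finrank_le_three_of_lie_lie_eq_zero [LieRing.IsNilpotent L] {x y : L}
    (hX : Submodule.span F {x, y} ⊔
      (⁅(⊤ : LieIdeal F L), (⊤ : LieIdeal F L)⁆ : LieIdeal F L).toSubmodule = ⊤)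
    (hx : ⁅⁅x, y⁆, x⁆ = 0) (hy : ⁅⁅x, y⁆, y⁆ = 0) : Module.finrank F L ≤ 3 := by
  classical
  have hx' : ⁅x, ⁅x, y⁆⁆ = 0 := by rw [← lie_skew, hx, neg_zero]
  have hy' : ⁅y, ⁅x, y⁆⁆ = 0 := by rw [← lie_skew, hy, neg_zero]
  let S : LieSubalgebra F L :=
    { Submodule.span F {x, y, ⁅x, y⁆} with
      lie_mem' := by
        intro a b ha hb
        simp only [AddSubsemigroup.mem_carrier, AddSubmonoid.mem_toSubsemigroup,
          Submodule.mem_toAddSubmonoid] at ha hb ⊢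
        obtain ⟨p, q, r, rfl⟩ := Submodule.mem_span_triple.1 ha
        obtain ⟨p', q', r', rfl⟩ := Submodule.mem_span_triple.1 hb
        refine Submodule.mem_span_triple.2 ⟨0, 0, p * q' - q * p', ?_⟩
        have hyx : ⁅y, x⁆ = -⁅x, y⁆ := (lie_skew y x).symm
        simp only [add_lie, lie_add, smul_lie, lie_smul, lie_self, hx, hy, hx', hy', hyx]
        module }
  have hS : S = ⊤ := by
    refine S.eq_top_of_sup_derived_eq_top (top_le_iff.1 (hX.ge.trans (sup_le_sup_right ?_ _)))
    exact Submodule.span_mono (by grind)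
  have hS' : Submodule.span F (({x, y, ⁅x, y⁆} : Finset L) : Set L) = ⊤ := by
    have := congrArg LieSubalgebra.toSubmodule hS
    simpa [S] using this
  rw [← finrank_top, ← hS']
  exact (finrank_span_finset_le_card _).trans Finset.card_le_three

end Generation

namespace LieNonabTensor

/-! ### Identities and spanning symbols in the tensor square -/

section Square

variable (F L : Type*) [Field F] [LieRing L] [LieAlgebra F L]

/-- The bilinear map sending `(l, k)` to the class of the symbol `l ⊗ k`. -/
noncomputable def tensorSquareMk : L →ₗ[F] L →ₗ[F] TensorSquare F L :=
  LinearMap.mk₂ F (fun l k => LieSubmodule.Quotient.mk (sym F l k))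
    (fun l l' k => by
      rw [← sub_eq_zero]
      exact (LieSubmodule.Quotient.mk_eq_zero' (N := relatorIdeal _ _)).2
        (LieSubmodule.subset_lieSpan (Relator.add_left l l' k)))
    (fun c l k => by
      rw [eq_comm, ← sub_eq_zero]
      exact (LieSubmodule.Quotient.mk_eq_zero' (N := relatorIdeal _ _)).2
        (LieSubmodule.subset_lieSpan (Relator.smul_left c l k)))
    (fun l k k' => by
      rw [← sub_eq_zero]
      exact (LieSubmodule.Quotient.mk_eq_zero' (N := relatorIdeal _ _)).2
        (LieSubmodule.subset_lieSpan (Relator.add_right l k k')))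
    (fun c l k => by
      rw [eq_comm, ← sub_eq_zero]
      exact (LieSubmodule.Quotient.mk_eq_zero' (N := relatorIdeal _ _)).2
        (LieSubmodule.subset_lieSpan (Relator.smul_right c l k)))

variable {L}

theorem tensorSquareMk_lie_left (l l' k : L) :
    tensorSquareMk F L ⁅l, l'⁆ k =
      tensorSquareMk F L l ⁅l', k⁆ - tensorSquareMk F L l' ⁅l, k⁆ := by
  have h := Relator.lie_left (α := LieDerivation.ad F L) (β := LieDerivation.ad F L) l l' k
  simp only [LieDerivation.ad_apply_apply] at h
  rw [← sub_eq_zero]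
  exact (LieSubmodule.Quotient.mk_eq_zero' (N := relatorIdeal _ _)).2
    (LieSubmodule.subset_lieSpan h)

theorem tensorSquareMk_lie_right (l k k' : L) :
    tensorSquareMk F L l ⁅k, k'⁆ =
      tensorSquareMk F L ⁅k', l⁆ k - tensorSquareMk F L ⁅k, l⁆ k' := by
  have h := Relator.lie_right (α := LieDerivation.ad F L) (β := LieDerivation.ad F L) l k k'
  simp only [LieDerivation.ad_apply_apply] at h
  rw [← sub_eq_zero]
  exact (LieSubmodule.Quotient.mk_eq_zero' (N := relatorIdeal _ _)).2
    (LieSubmodule.subset_lieSpan h)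

theorem lie_tensorSquareMk (l k l' k' : L) :
    ⁅tensorSquareMk F L l k, tensorSquareMk F L l' k'⁆ =
      -tensorSquareMk F L ⁅k, l⁆ ⁅l', k'⁆ := by
  have h := Relator.lie_lie (α := LieDerivation.ad F L) (β := LieDerivation.ad F L) l l' k k'
  simp only [LieDerivation.ad_apply_apply] at h
  rw [← sub_eq_zero]
  exact (LieSubmodule.Quotient.mk_eq_zero' (N := relatorIdeal _ _)).2
    (LieSubmodule.subset_lieSpan h)

/-- Up to sign this is the bracket of `l ⊗ k` with itself, so it vanishes in every characteristic.
-/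
theorem tensorSquareMk_lie_lie_self (l k : L) :
    tensorSquareMk F L ⁅l, k⁆ ⁅l, k⁆ = 0 := by
  have h := lie_tensorSquareMk F l k l k
  rwa [lie_self, ← lie_skew k l, map_neg, LinearMap.neg_apply, neg_neg, eq_comm] at h

/-- The symmetrization of the tensor symbol vanishes when one argument is a bracket. -/
theorem tensorSquareMk_lie_swap (l a b : L) :
    tensorSquareMk F L l ⁅a, b⁆ = -tensorSquareMk F L ⁅a, b⁆ l := by
  set t := tensorSquareMk F L
  have skew : ∀ u v w : L, t w ⁅u, v⁆ = - t w ⁅v, u⁆ := fun u v w => by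
    rw [← lie_skew u v, map_neg]
  have skew' : ∀ u v w : L, t ⁅u, v⁆ w = - t ⁅v, u⁆ w := fun u v w => by
    rw [← lie_skew u v, map_neg, LinearMap.neg_apply]
  -- `T` changes sign under both adjacent transpositions, so it is invariant under cyclic shifts.
  -- The relations also make it the sum of its two other cyclic shifts, whence `T = T + T`.
  let T : L → L → L → TensorSquare F L := fun l a b => t l ⁅a, b⁆ + t ⁅a, b⁆ l
  have hself : ∀ a b, T a a b = 0 := fun a b => by
    simp only [T]
    rw [show t a ⁅a, b⁆ = t ⁅b, a⁆ a - t ⁅a, a⁆ b from tensorSquareMk_lie_right F a a b,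
      lie_self, skew' b a]
    simp
  have hpol : ∀ a l b, T a l b = - T l a b := fun a l b => by
    have h := hself (a + l) b
    have h1 := hself a b
    have h2 := hself l b
    simp only [T, add_lie, map_add, LinearMap.add_apply] at h h1 h2 ⊢
    have e : t a ⁅l, b⁆ + t ⁅l, b⁆ a + (t l ⁅a, b⁆ + t ⁅a, b⁆ l) =
        (t a ⁅a, b⁆ + t l ⁅a, b⁆ + (t a ⁅l, b⁆ + t l ⁅l, b⁆) +
          (t ⁅a, b⁆ a + t ⁅l, b⁆ a + (t ⁅a, b⁆ l + t ⁅l, b⁆ l))) -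
        (t a ⁅a, b⁆ + t ⁅a, b⁆ a) - (t l ⁅l, b⁆ + t ⁅l, b⁆ l) := by abel
    rw [eq_neg_iff_add_eq_zero, e, h1, h2, sub_zero, sub_zero, ← h]
  have hskew : ∀ a l b, T a l b = - T a b l := fun a l b => by
    simp only [T]
    rw [skew l b, skew' l b]
    abel
  have hcyc : T l a b = T a b l + T b l a := by
    simp only [T]
    rw [show t l ⁅a, b⁆ = t ⁅b, l⁆ a - t ⁅a, l⁆ b from tensorSquareMk_lie_right F l a b,
      show t ⁅a, b⁆ l = t a ⁅b, l⁆ - t b ⁅a, l⁆ from tensorSquareMk_lie_left F a b l,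
      skew a l, skew' a l]
    abel
  have h1 : T a b l = T l a b := by rw [hskew, hpol, neg_neg]
  have h2 : T b l a = T l a b := by rw [hpol, hskew, neg_neg]
  rw [h1, h2, left_eq_add] at hcyc
  exact eq_neg_of_add_eq_zero_left hcyc

theorem tensorSquareMk_jacobi (a b c : L) :
    tensorSquareMk F L ⁅a, b⁆ c + tensorSquareMk F L ⁅b, c⁆ a - tensorSquareMk F L ⁅a, c⁆ b = 0 := by
  rw [tensorSquareMk_lie_left F a b c, tensorSquareMk_lie_swap F a b c,
    tensorSquareMk_lie_swap F b a c]
  abel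

variable (L) in
/-- The tensor square is spanned by the symbols as a vector space. -/
theorem range_lift_tensorSquareMk :
    LinearMap.range (TensorProduct.lift (tensorSquareMk F L)) = ⊤ := by
  -- The span of the symbols is closed under brackets by the last relation, and the quotient map
  -- factors through it.
  let U : LieSubalgebra F (TensorSquare F L) :=
    { LinearMap.range (TensorProduct.lift (tensorSquareMk F L)) with
      lie_mem' := by
        rintro _ _ ⟨u, rfl⟩ ⟨v, rfl⟩
        induction u with
        | zero => simp
        | add u u' hu hu' =>
          rw [map_add, add_lie]
          exact Submodule.add_mem _ hu hu'
        | tmul l k =>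
          induction v with
          | zero => simp
          | add v v' hv hv' =>
            rw [map_add, lie_add]
            exact Submodule.add_mem _ hv hv'
          | tmul l' k' =>
            refine ⟨-(⁅k, l⁆ ⊗ₜ ⁅l', k'⁆), ?_⟩
            rw [map_neg, lift.tmul, lift.tmul, lift.tmul, lie_tensorSquareMk] }
  let f : FreeLieAlgebra F (L × L) →ₗ⁅F⁆ U :=
    FreeLieAlgebra.lift F fun p => ⟨tensorSquareMk F L p.1 p.2, p.1 ⊗ₜ p.2, lift.tmul _ _⟩
  let π : FreeLieAlgebra F (L × L) →ₗ⁅F⁆ TensorSquare F L :=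
    { (LieSubmodule.Quotient.mk' (relatorIdeal (LieDerivation.ad F L) (LieDerivation.ad F L)) :
        FreeLieAlgebra F (L × L) →ₗ[F] TensorSquare F L) with
      map_lie' := fun {x y} => LieSubmodule.Quotient.mk_bracket _ x y }
  have hf : U.incl.comp f = π := by
    refine FreeLieAlgebra.hom_ext fun p => ?_
    simp only [LieHom.comp_apply, f, FreeLieAlgebra.lift_of_apply]
    rfl
  rw [eq_top_iff]
  intro v _
  obtain ⟨w, rfl⟩ := LieSubmodule.Quotient.surjective_mk'
    (relatorIdeal (LieDerivation.ad F L) (LieDerivation.ad F L)) v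
  have hw : (f w : TensorSquare F L) = π w := by rw [← hf]; rfl
  exact hw ▸ (f w).2

instance [Module.Finite F L] : Module.Finite F (TensorSquare F L) :=
  Module.Finite.of_surjective _ (LinearMap.range_eq_top.1 (range_lift_tensorSquareMk F L))

/-! ### The surjection from `L ⊗ X` and its kernel -/

variable {F}

/-- The restriction of the tensor symbol to right arguments in a subspace. -/
noncomputable def tensorSquareLift (X : Submodule F L) : L ⊗[F] X →ₗ[F] TensorSquare F L :=
  TensorProduct.lift ((tensorSquareMk F L).compl₂ X.subtype)

@[simp]
theorem tensorSquareLift_tmul (X : Submodule F L) (l : L) (x : X) :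
    tensorSquareLift X (l ⊗ₜ x) = tensorSquareMk F L l x := by
  simp [tensorSquareLift]

/-- With `D = [L, L]` and `W` the range, the `z` with `D ⊗ z ⊆ W` form a subalgebra, as `c ⊗ ⁅a, b⁆
= ⁅b, c⁆ ⊗ a - ⁅a, c⁆ ⊗ b`. It contains `X`, so `D ⊗ L ⊆ W`; the same relation then gives `L ⊗ D ⊆
W`. -/
theorem tensorSquareLift_range [LieRing.IsNilpotent L] {X : Submodule F L}
    (hX : X ⊔ (⁅(⊤ : LieIdeal F L), (⊤ : LieIdeal F L)⁆ : LieIdeal F L).toSubmodule = ⊤) :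
    LinearMap.range (tensorSquareLift X) = ⊤ := by
  set W := LinearMap.range (tensorSquareLift X)
  set D : LieIdeal F L := ⁅(⊤ : LieIdeal F L), (⊤ : LieIdeal F L)⁆
  have hD : ∀ a b : L, ⁅a, b⁆ ∈ D := fun a b =>
    LieSubmodule.lie_mem_lie (LieSubmodule.mem_top a) (LieSubmodule.mem_top b)
  let S : LieSubalgebra F L :=
    { carrier := {z | ∀ c ∈ D, tensorSquareMk F L c z ∈ W}
      add_mem' := fun ha hb c hc => by
        rw [map_add]
        exact add_mem (ha c hc) (hb c hc)
      zero_mem' := fun c _ => by simp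
      smul_mem' := fun r a ha c hc => by
        rw [map_smul]
        exact W.smul_mem r (ha c hc)
      lie_mem' := fun {a b} ha hb c _ => by
        rw [tensorSquareMk_lie_right]
        exact sub_mem (ha _ (hD _ _)) (hb _ (hD _ _)) }
  have hXW : ∀ (l : L), ∀ x ∈ X, tensorSquareMk F L l x ∈ W := fun l x hx =>
    ⟨l ⊗ₜ ⟨x, hx⟩, tensorSquareLift_tmul X l ⟨x, hx⟩⟩
  have hS : S = ⊤ := by
    refine S.eq_top_of_sup_derived_eq_top (top_le_iff.1 (hX.ge.trans (sup_le_sup_right ?_ _)))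
    exact fun x hx c _ => hXW c x hx
  have hDW : ∀ c ∈ D, ∀ z, tensorSquareMk F L c z ∈ W := fun c hc z =>
    (hS ▸ LieSubalgebra.mem_top z : z ∈ S) c hc
  have hWD : ∀ z, ∀ c ∈ D, tensorSquareMk F L z c ∈ W := by
    intro z c hc
    rw [← LieSubmodule.mem_toSubmodule, LieSubmodule.lieIdeal_oper_eq_linear_span'] at hc
    induction hc using Submodule.span_induction with
    | mem c hc =>
      obtain ⟨a, -, b, -, rfl⟩ := hc
      rw [tensorSquareMk_lie_right]
      exact sub_mem (hDW _ (hD _ _) _) (hDW _ (hD _ _) _)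
    | zero => simp
    | add u v _ _ hu hv => rw [map_add]; exact add_mem hu hv
    | smul r u _ hu => rw [map_smul]; exact W.smul_mem r hu
  rw [eq_top_iff, ← range_lift_tensorSquareMk]
  rintro _ ⟨u, rfl⟩
  induction u with
  | zero => simp
  | add u v hu hv => rw [map_add]; exact add_mem hu hv
  | tmul l k =>
    obtain ⟨x, hx, c, hc, rfl⟩ := Submodule.mem_sup.1 (hX ▸ Submodule.mem_top : k ∈ X ⊔ _)
    rw [lift.tmul, map_add]
    exact add_mem (hXW l x hx) (hWD l c hc)

theorem finrank_tensorSquare_add_finrank_ker [Module.Finite F L] [LieRing.IsNilpotent L]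
    {X : Submodule F L}
    (hX : X ⊔ (⁅(⊤ : LieIdeal F L), (⊤ : LieIdeal F L)⁆ : LieIdeal F L).toSubmodule = ⊤) :
    Module.finrank F (TensorSquare F L) + Module.finrank F (LinearMap.ker (tensorSquareLift X)) =
      Module.finrank F L * Module.finrank F X := by
  rw [← Module.finrank_tensorProduct, ← (tensorSquareLift X).finrank_range_add_finrank_ker,
    tensorSquareLift_range hX, finrank_top]

/-- The Jacobi relators give a large kernel. -/
theorem finrank_le_finrank_ker_tensorSquareLift_add_two [Module.Finite F L]
    {X : Submodule F L} {x y : X} (hxy : ⁅(x : L), (y : L)⁆ ≠ 0) :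
    Module.finrank F X ≤ Module.finrank F (LinearMap.ker (tensorSquareLift X)) + 2 := by
  classical
  let P : Submodule F X := Submodule.span F (({x, y} : Finset X) : Set X)
  have hxP : x ∈ P := Submodule.subset_span (by simp)
  have hyP : y ∈ P := Submodule.subset_span (by simp)
  let R : X →ₗ[F] L ⊗[F] X :=
    TensorProduct.mk F L X ⁅(x : L), (y : L)⁆ +
      (TensorProduct.mk F L X).flip x ∘ₗ (LieAlgebra.ad F L (y : L) : L →ₗ[F] L) ∘ₗ X.subtype -
      (TensorProduct.mk F L X).flip y ∘ₗ (LieAlgebra.ad F L (x : L) : L →ₗ[F] L) ∘ₗ X.subtype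
  have hR : ∀ z : X, R z = ⁅(x : L), (y : L)⁆ ⊗ₜ z + ⁅(y : L), (z : L)⁆ ⊗ₜ x -
      ⁅(x : L), (z : L)⁆ ⊗ₜ y := fun z => rfl
  have hrange : LinearMap.range R ≤ LinearMap.ker (tensorSquareLift X) := by
    rintro _ ⟨z, rfl⟩
    rw [LinearMap.mem_ker, hR]
    simpa using tensorSquareMk_jacobi F (x : L) (y : L) (z : L)
  have hker : LinearMap.ker R ≤ P := by
    intro z hz
    -- Applying `φ` on the left and reducing modulo `P` on the right kills the terms in `x` and `y`,
    -- leaving `φ ⁅x, y⁆` times the class of `z`.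
    obtain ⟨φ, hφ⟩ : ∃ φ : Module.Dual F L, φ ⁅(x : L), (y : L)⁆ ≠ 0 := by
      by_contra! h
      exact hxy ((Module.forall_dual_apply_eq_zero_iff F _).1 h)
    have h := congrArg (TensorProduct.lift (φ.smulRight P.mkQ)) (LinearMap.mem_ker.1 hz)
    have hx0 : P.mkQ x = 0 := by simpa using hxP
    have hy0 : P.mkQ y = 0 := by simpa using hyP
    rw [hR] at h
    simp only [map_add, map_sub, lift.tmul, LinearMap.smulRight_apply, LinearMap.smul_apply, hx0,
      hy0, smul_zero, add_zero, sub_zero, map_zero, smul_eq_zero, hφ, false_or] at h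
    simpa using h
  have h1 := R.finrank_range_add_finrank_ker
  have h2 := Submodule.finrank_mono hrange
  have h3 := Submodule.finrank_mono hker
  have h4 : Module.finrank F P ≤ 2 := (finrank_span_finset_le_card _).trans Finset.card_le_two
  omega

/-- The witness is `c ⊗ ⁅x, y⁆` expanded in `L ⊗ X`. As `x, y` is a basis of `X`, its vanishing
would make `c` commute with both, forcing `dim L ≤ 3`. -/
theorem finrank_ker_tensorSquareLift_pos [Module.Finite F L] [LieRing.IsNilpotent L]
    {X : Submodule F L}
    (hX : X ⊔ (⁅(⊤ : LieIdeal F L), (⊤ : LieIdeal F L)⁆ : LieIdeal F L).toSubmodule = ⊤)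
    (hL : 3 < Module.finrank F L) (hX2 : Module.finrank F X = 2)
    {x y : X} (hxy : ⁅(x : L), (y : L)⁆ ≠ 0) :
    0 < Module.finrank F (LinearMap.ker (tensorSquareLift X)) := by
  have hli : LinearIndependent F ![x, y] := by
    refine LinearIndependent.of_comp X.subtype ?_
    convert linearIndependent_pair_of_lie_ne_zero (F := F) hxy using 1
    ext i
    fin_cases i <;> rfl
  let b := basisOfLinearIndependentOfCardEqFinrank hli (by simp [hX2])
  have hb0 : b 0 = x := by simp [b]
  have hb1 : b 1 = y := by simp [b]
  set c := ⁅(x : L), (y : L)⁆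
  have hmem : ⁅(y : L), c⁆ ⊗ₜ[F] x - ⁅(x : L), c⁆ ⊗ₜ[F] y ∈
      LinearMap.ker (tensorSquareLift X) := by
    rw [LinearMap.mem_ker, map_sub, tensorSquareLift_tmul, tensorSquareLift_tmul,
      ← tensorSquareMk_lie_right, tensorSquareMk_lie_lie_self]
  rw [Module.finrank_pos_iff_exists_ne_zero]
  refine ⟨⟨_, hmem⟩, fun h0 => ?_⟩
  replace h0 := congrArg Subtype.val h0
  have hcoord : ∀ i, b.coord i x • ⁅(y : L), c⁆ - b.coord i y • ⁅(x : L), c⁆ = 0 := fun i => by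
    simpa using congrArg (TensorProduct.rid F L ∘ LinearMap.lTensor L (b.coord i)) h0
  have hy : ⁅(y : L), c⁆ = 0 := by
    have hx1 : b.coord 0 x = 1 := by rw [← hb0]; simp
    have hy1 : b.coord 0 y = 0 := by rw [← hb1]; simp
    simpa [hx1, hy1] using hcoord 0
  have hx : ⁅c, (x : L)⁆ = 0 := by
    have hx1 : b.coord 1 x = 0 := by rw [← hb0]; simp
    have hy1 : b.coord 1 y = 1 := by rw [← hb1]; simp
    simpa [hx1, hy1] using hcoord 1
  have hspan : X ≤ Submodule.span F {(x : L), (y : L)} := by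
    intro z hz
    refine Submodule.mem_span_pair.2 ⟨b.repr ⟨z, hz⟩ 0, b.repr ⟨z, hz⟩ 1, ?_⟩
    have := congrArg Subtype.val (b.sum_repr ⟨z, hz⟩)
    rw [Fin.sum_univ_two, hb0, hb1] at this
    simpa using this
  refine absurd (finrank_le_three_of_lie_lie_eq_zero (x := (x : L)) (y := (y : L))
    (top_le_iff.1 (hX.ge.trans (sup_le_sup_right hspan _))) ?_ ?_) (not_le.2 hL)
  · exact hx
  · rw [← lie_skew, hy, neg_zero]

end Square

end LieNonabTensor

theorem proposition3p5 {F : Type*} [Field F] {L : Type*} [LieRing L] [LieAlgebra F L]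
    [Module.Finite F L] [LieRing.IsNilpotent L] (hnab : ¬ IsLieAbelian L) (n m : ℕ)
    (hn : Module.finrank F L = n)
    (hm : Module.finrank F (⁅(⊤ : LieIdeal F L), (⊤ : LieIdeal F L)⁆ : LieIdeal F L) = m)
    (hn4 : 4 ≤ n) (hm2 : 2 ≤ m) :
    Module.Finite F (LieNonabTensor.TensorSquare F L) ∧
    ((Module.finrank F (LieNonabTensor.TensorSquare F L) : ℤ) ≤ ((n : ℤ) - m) * (n - 1) + 1 ∨
      ((Module.finrank F (LieNonabTensor.TensorSquare F L) : ℤ) ≤ ((n : ℤ) - m) * (n - 1) + 2 ∧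
        ((n : ℤ) - m) * (n - 1) + 2 < (n : ℤ) * ((n : ℤ) - m))) ∧
    (Module.finrank F (LieNonabTensor.TensorSquare F L) : ℤ) < (n : ℤ) * ((n : ℤ) - m) := by
  obtain ⟨X, hX⟩ := Submodule.exists_isCompl
    (⁅(⊤ : LieIdeal F L), (⊤ : LieIdeal F L)⁆ : LieIdeal F L).toSubmodule
  have hsup := hX.symm.sup_eq_top
  have hdim : m + Module.finrank F X = n := by
    rw [← hm, ← hn]
    exact Submodule.finrank_add_eq_of_isCompl hX
  obtain ⟨x, hx, y, hy, hxy⟩ := exists_lie_ne_zero_of_sup_derived_eq_top hsup hnab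
  lift x to X using hx
  lift y to X using hy
  have hd2 : 2 ≤ Module.finrank F X := by
    have h := (linearIndependent_pair_of_lie_ne_zero (F := F) hxy)
    have hli : LinearIndependent F ![x, y] := by
      refine LinearIndependent.of_comp X.subtype ?_
      convert h using 1
      ext i
      fin_cases i <;> rfl
    simpa using hli.fintype_card_le_finrank
  have hker := LieNonabTensor.finrank_le_finrank_ker_tensorSquareLift_add_two hxy
  have htot := LieNonabTensor.finrank_tensorSquare_add_finrank_ker hsup
  have hpos := LieNonabTensor.finrank_ker_tensorSquareLift_pos hsup (by omega) (x := x) (y := y)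
    (hxy := hxy)
  rw [hn] at htot
  have hd : (n : ℤ) - m = Module.finrank F X := by omega
  rw [hd]
  refine ⟨inferInstance, ?_⟩
  zify at htot hker hd2
  have e : (Module.finrank F X : ℤ) * (n - 1) = n * Module.finrank F X - Module.finrank F X := by
    ring
  rw [e]
  -- For `d = 2`, `n * d - 1 = d * (n - 1) + 1`, the first alternative. For `d ≥ 3`, `n * d - (d -
  -- 2) = d * (n - 1) + 2 < n * d`, the second.
  rcases hd2.eq_or_lt with h2 | h3
  · have := hpos (by omega)
    omega
  · omega
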